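/- Let $d\in\mathbb N$, let $T\ge 0$, and let $p:[0,T]\times\mathbb R^d\to\mathbb R$ be such that each $p(t,\cdot)$ is a probability density; put $\mu_t(dx)=p(t,x)\,dx$. Let $K:\mathbb R^{d+1}\to\mathbb R$, let $K(\xi,\eta)=K(\xi-\eta)$ be the associated translation-invariant kernel, and let $\mathcal H$ be its reproducing kernel Hilbert space (of functions on $\mathbb R^{d+1}$), with norm $\|\cdot\|$. We write $K(t,x,s,y)=K((t,x)-(s,y))$. Assume: * (A1) $K\in C(\mathbb R^{d+1})\cap L^1(\mathbb R^{d+1})$ is positive definite (i.e. $K(-\xi)=K(\xi)$ and $\sum_{i,j}c_ic_jK(\xi_i-\xi_j)\ge 0$ for all finitely many $\xi_i\in\mathbb R^{d+1}$, $c_i\in\mathbb R$), and $\mathcal H$ is universal on every compact $Z\subset[0,T]\times\mathbb R^d$, i.e. the restrictions to $Z$ of the elements of $\mathcal H$ are uniformly dense in $C(Z)$. * (A2) The Fourier transform $\widehat K$ satisfies $\int_{\mathbb R^{d+1}}(1+|z|^2)\widehat K(z)\,dz<\infty$ (absolutely convergent; $\widehat K\ge0$ by (A1)). * (A3) $p\in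 C([0,T];L^1(\mathbb R^d))\cap L^\infty([0,T]\times\mathbb R^d)$, and the weak derivative $\partial_tp$ belongs to $L^1((0,T)\times\mathbb R^d)$. Let $u\in L^1([0,T]\times\mathbb R^d;\mathbb R^d,p(t,x)\,dt\,dx)$ and let $\mathcal A^u\varphi=\partial_t\varphi+u^{\mathsf T}\nabla_x\varphi$; a subscript indicates the variables on which $\mathcal A^u$ acts. For $t\in[0,T]$ and $\xi\in\mathbb R^{d+1}$ let $$H_t^u(\xi)=\int_0^t\!\int_{\mathbb R^d}p(r,y)\,\mathcal A^u_{r,y}K(\xi,(r,y))\,dy\,dr-\int_{\mathbb R^d}p(t,y)K(\xi,(t,y))\,dy+\int_{\mathbb R^d}p(0,y)K(\xi,(0,y))\,dy .$$ Let $(X_t)_{0\le t\le T}$ and $(\tilde X_t)_{0\le t\le T}$ be independent continuous processes on one probability space with $X_t,\tilde X_t\sim\mu_t$ for every $t\in[0,T]$. Then $K\in C^2$, all integrals defining $H_t^u$ converge absolutely, $H_t^u\in\mathcal H$, and for every $t\in[0,T]$ $$\|H_t^u\|^2=I_1(t)+I_2(t)+I_3(t)-2I_4(t)-2I_5(t)+2I_6(t),$$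 where $$\begin{aligned} I_1(t)&=\int_0^t\!\!\int_0^t\mathbb E\bigl[\mathcal A^u_{s}\mathcal A^u_{r}K(s,X_s,r,\tilde X_r)\bigr]\,ds\,dr, & I_2(t)&=\mathbb E\bigl[K(t,X_t,t,\tilde X_t)\bigr],\\ I_3(t)&=\mathbb E\bigl[K(0,X_0,0,\tilde X_0)\bigr], & I_4(t)&=\int_0^t\mathbb E\bigl[\mathcal A^u_{s}K(t,X_t,s,\tilde X_s)\bigr]\,ds,\\ I_5(t)&=\mathbb E\bigl[K(0,X_0,t,\tilde X_t)\bigr], & I_6(t)&=\int_0^t\mathbb E\bigl[\mathcal A^u_{s}K(0,X_0,s,\tilde X_s)\bigr]\,ds . \end{aligned}$$ Here, in $I_1$, $\mathcal A^u_s$ and $\mathcal A^u_r$ act on the first and second space-time argument of the kernel; in $I_4$ and $I_6$, $\mathcal A^u_s$ acts on the second one. The derivatives are taken before the processes are inserted. The expectations inside the time integrals exist for almost every time (pair of times) and are integrable there. -/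

import Mathlib

open MeasureTheory ProbabilityTheory Filter Topology
open scoped FourierTransform

noncomputable section

/-- The point `(t, x)` of `ℝ^{d+1}`, with `t` as its zeroth coordinate. -/
def spaceTime {d : ℕ} (t : ℝ) (x : EuclideanSpace ℝ (Fin d)) : EuclideanSpace ℝ (Fin (d + 1)) :=
  WithLp.toLp 2 (Fin.cons t (fun i => x i) : Fin (d + 1) → ℝ)

/-- The set `[0,T] × ℝ^d` as a subset of `ℝ^{d+1}`. -/
def spaceTimeSlab (d : ℕ) (T : ℝ) : Set (EuclideanSpace ℝ (Fin (d + 1))) :=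
  {ξ | ξ 0 ∈ Set.Icc (0 : ℝ) T}

/-- The translation-invariant scalar kernel `(ξ, η) ↦ K (ξ - η)`, in the operator-valued form used
by `RKHS.kernel`: its entries are the multiplication operators on `ℝ` by `K (ξ - η)`. -/
def translationKernel {V : Type*} [AddCommGroup V] (K : V → ℝ) : Matrix V V (ℝ →L[ℝ] ℝ) :=
  Matrix.of fun ξ η => K (ξ - η) • ContinuousLinearMap.id ℝ ℝ

/-- `K (ξ - η)` is a (symmetric, real-valued) positive definite kernel. -/
structure IsPositiveDefiniteFun {V : Type*} [AddCommGroup V] (K : V → ℝ) : Prop where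
  even : ∀ ξ, K (-ξ) = K ξ
  nonneg : ∀ (n : ℕ) (ξ : Fin n → V) (c : Fin n → ℝ),
    0 ≤ ∑ i, ∑ j, c i * c j * K (ξ i - ξ j)

/-- A space `H` of functions is universal on `Z`: the restrictions to `Z` of its
elements are uniformly dense in the continuous functions on `Z`. -/
def UniversalOn (H : Type*) {V : Type*} [TopologicalSpace V]
    [NormedAddCommGroup H] [InnerProductSpace ℝ H] [RKHS ℝ H V ℝ] (Z : Set V) : Prop :=
  ∀ g : V → ℝ, ContinuousOn g Z → ∀ ε > 0, ∃ f : H, ∀ z ∈ Z, |f z - g z| < ε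

/-- Assumption (A1) on the kernel profile `K`, where `H` is the reproducing kernel Hilbert space
induced by `K`. -/
structure AssumptionA1 {d : ℕ} (T : ℝ) (K : EuclideanSpace ℝ (Fin (d + 1)) → ℝ)
    (H : Type*) [NormedAddCommGroup H] [InnerProductSpace ℝ H]
    [RKHS ℝ H (EuclideanSpace ℝ (Fin (d + 1))) ℝ] : Prop where
  continuous : Continuous K
  integrable : Integrable K
  positiveDefinite : IsPositiveDefiniteFun K
  universal : ∀ Z ⊆ spaceTimeSlab d T, IsCompact Z → UniversalOn H Z

/-- Assumption (A2): `∫ (1 + |z|²) K̂(z) dz < ∞`.  The condition does not depend on the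
normalization chosen for the Fourier transform. -/
def AssumptionA2 {d : ℕ} (K : EuclideanSpace ℝ (Fin (d + 1)) → ℝ) : Prop :=
  Integrable fun z : EuclideanSpace ℝ (Fin (d + 1)) =>
    ((1 + ‖z‖ ^ 2 : ℝ) : ℂ) * 𝓕 (fun ξ => (K ξ : ℂ)) z

/-- Lebesgue measure on `[0,T] × ℝ^d`. -/
def slabMeasure (d : ℕ) (T : ℝ) : Measure (ℝ × EuclideanSpace ℝ (Fin d)) :=
  volume.restrict (Set.Icc (0 : ℝ) T ×ˢ Set.univ)

/-- `q` is the weak time derivative of `p` on `(0,T) × ℝ^d`. -/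
def IsWeakTimeDeriv {d : ℕ} (T : ℝ) (p q : ℝ → EuclideanSpace ℝ (Fin d) → ℝ) : Prop :=
  ∀ φ : ℝ × EuclideanSpace ℝ (Fin d) → ℝ, ContDiff ℝ (⊤ : ℕ∞) φ → HasCompactSupport φ →
    tsupport φ ⊆ Set.Ioo (0 : ℝ) T ×ˢ Set.univ →
    ∫ z, p z.1 z.2 * fderiv ℝ φ z (1, 0) ∂(slabMeasure d T) =
      -∫ z, q z.1 z.2 * φ z ∂(slabMeasure d T)

/-- Assumption (A3) on the marginal flow `p`. -/
structure AssumptionA3 {d : ℕ} (T : ℝ) (p : ℝ → EuclideanSpace ℝ (Fin d) → ℝ) : Prop where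
  integrable : ∀ t ∈ Set.Icc (0 : ℝ) T, Integrable (p t)
  nonneg : ∀ t ∈ Set.Icc (0 : ℝ) T, 0 ≤ᵐ[volume] p t
  integral_eq_one : ∀ t ∈ Set.Icc (0 : ℝ) T, ∫ x, p t x = 1
  continuous_L1 : ∀ t ∈ Set.Icc (0 : ℝ) T,
    Tendsto (fun s => eLpNorm (p s - p t) 1 volume) (𝓝[Set.Icc (0 : ℝ) T] t) (𝓝 0)
  memLp_top : MemLp (fun z : ℝ × EuclideanSpace ℝ (Fin d) => p z.1 z.2) ⊤ (slabMeasure d T)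
  weakTimeDeriv : ∃ q : ℝ → EuclideanSpace ℝ (Fin d) → ℝ,
    Integrable (fun z : ℝ × EuclideanSpace ℝ (Fin d) => q z.1 z.2) (slabMeasure d T) ∧
      IsWeakTimeDeriv T p q

/-- The marginal law `μ_t(dx) = p(t,x) dx`. -/
def marginalLaw {d : ℕ} (p : ℝ → EuclideanSpace ℝ (Fin d) → ℝ) (t : ℝ) :
    Measure (EuclideanSpace ℝ (Fin d)) :=
  volume.withDensity fun x => ENNReal.ofReal (p t x)

/-- `u ∈ L¹([0,T] × ℝ^d; ℝ^d, p(t,x) dt dx)`. -/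
def VelocityL1 {d : ℕ} (T : ℝ) (p : ℝ → EuclideanSpace ℝ (Fin d) → ℝ)
    (u : ℝ → EuclideanSpace ℝ (Fin d) → EuclideanSpace ℝ (Fin d)) : Prop :=
  Integrable (fun z : ℝ × EuclideanSpace ℝ (Fin d) => u z.1 z.2)
    ((slabMeasure d T).withDensity fun z => ENNReal.ofReal (p z.1 z.2))

/-- The operator `𝒜^u φ = ∂_t φ + uᵀ ∇_x φ`, evaluated at `(t, x)`. -/
def transportOp {d : ℕ} (u : ℝ → EuclideanSpace ℝ (Fin d) → EuclideanSpace ℝ (Fin d))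
    (φ : ℝ → EuclideanSpace ℝ (Fin d) → ℝ) (t : ℝ) (x : EuclideanSpace ℝ (Fin d)) : ℝ :=
  deriv (fun s => φ s x) t + inner ℝ (u t x) (gradient (φ t) x)

/-- `𝒜^u_{r,y} K(ξ, (r,y))`: the operator acts on the second argument of the kernel. -/
def opKernel {d : ℕ} (K : EuclideanSpace ℝ (Fin (d + 1)) → ℝ)
    (u : ℝ → EuclideanSpace ℝ (Fin d) → EuclideanSpace ℝ (Fin d))
    (ξ : EuclideanSpace ℝ (Fin (d + 1))) (r : ℝ) (y : EuclideanSpace ℝ (Fin d)) : ℝ :=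
  transportOp u (fun r' y' => K (ξ - spaceTime r' y')) r y

/-- `𝒜^u_{s,x} 𝒜^u_{r,y} K((s,x), (r,y))`: the operator acts on both arguments of the kernel. -/
def opOpKernel {d : ℕ} (K : EuclideanSpace ℝ (Fin (d + 1)) → ℝ)
    (u : ℝ → EuclideanSpace ℝ (Fin d) → EuclideanSpace ℝ (Fin d))
    (s : ℝ) (x : EuclideanSpace ℝ (Fin d)) (r : ℝ) (y : EuclideanSpace ℝ (Fin d)) : ℝ :=
  transportOp u (fun s' x' => opKernel K u (spaceTime s' x') r y) s x

/-- The function `H_s^u` on `ℝ^{d+1}`. -/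
def residualFun {d : ℕ} (K : EuclideanSpace ℝ (Fin (d + 1)) → ℝ)
    (p : ℝ → EuclideanSpace ℝ (Fin d) → ℝ)
    (u : ℝ → EuclideanSpace ℝ (Fin d) → EuclideanSpace ℝ (Fin d))
    (s : ℝ) (ξ : EuclideanSpace ℝ (Fin (d + 1))) : ℝ :=
  (∫ r in (0 : ℝ)..s, ∫ y, p r y * opKernel K u ξ r y)
    - (∫ y, p s y * K (ξ - spaceTime s y))
    + ∫ y, p 0 y * K (ξ - spaceTime 0 y)

/-- All derivatives and integrals in the definition of `H_s^u` exist. -/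
structure ResidualWellDefined {d : ℕ} (K : EuclideanSpace ℝ (Fin (d + 1)) → ℝ)
    (p : ℝ → EuclideanSpace ℝ (Fin d) → ℝ)
    (u : ℝ → EuclideanSpace ℝ (Fin d) → EuclideanSpace ℝ (Fin d)) (s : ℝ) : Prop where
  contDiff : ContDiff ℝ 2 K
  bulk : ∀ ξ, Integrable (fun z : ℝ × EuclideanSpace ℝ (Fin d) =>
    p z.1 z.2 * opKernel K u ξ z.1 z.2) (slabMeasure d s)
  terminal : ∀ ξ, Integrable fun y => p s y * K (ξ - spaceTime s y)
  initial : ∀ ξ, Integrable fun y => p 0 y * K (ξ - spaceTime 0 y)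

section Terms

variable {d : ℕ} {Ω : Type*} [MeasurableSpace Ω]

/-- `I₁(t) = ∫₀ᵗ ∫₀ᵗ 𝔼[𝒜^u_s 𝒜^u_r K(s, X_s, r, X̃_r)] ds dr`. -/
def termI1 (P : Measure Ω) (K : EuclideanSpace ℝ (Fin (d + 1)) → ℝ)
    (u : ℝ → EuclideanSpace ℝ (Fin d) → EuclideanSpace ℝ (Fin d))
    (X X' : ℝ → Ω → EuclideanSpace ℝ (Fin d)) (t : ℝ) : ℝ :=
  ∫ r in (0 : ℝ)..t, ∫ s in (0 : ℝ)..t, ∫ ω, opOpKernel K u s (X s ω) r (X' r ω) ∂P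

/-- `I₂(t) = 𝔼[K(t, X_t, t, X̃_t)]`. -/
def termI2 (P : Measure Ω) (K : EuclideanSpace ℝ (Fin (d + 1)) → ℝ)
    (X X' : ℝ → Ω → EuclideanSpace ℝ (Fin d)) (t : ℝ) : ℝ :=
  ∫ ω, K (spaceTime t (X t ω) - spaceTime t (X' t ω)) ∂P

/-- `I₃ = 𝔼[K(0, X_0, 0, X̃_0)]`. -/
def termI3 (P : Measure Ω) (K : EuclideanSpace ℝ (Fin (d + 1)) → ℝ)
    (X X' : ℝ → Ω → EuclideanSpace ℝ (Fin d)) : ℝ :=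
  ∫ ω, K (spaceTime 0 (X 0 ω) - spaceTime 0 (X' 0 ω)) ∂P

/-- `I₄(t) = ∫₀ᵗ 𝔼[𝒜^u_s K(t, X_t, s, X̃_s)] ds`. -/
def termI4 (P : Measure Ω) (K : EuclideanSpace ℝ (Fin (d + 1)) → ℝ)
    (u : ℝ → EuclideanSpace ℝ (Fin d) → EuclideanSpace ℝ (Fin d))
    (X X' : ℝ → Ω → EuclideanSpace ℝ (Fin d)) (t : ℝ) : ℝ :=
  ∫ s in (0 : ℝ)..t, ∫ ω, opKernel K u (spaceTime t (X t ω)) s (X' s ω) ∂P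

/-- `I₅(t) = 𝔼[K(0, X_0, t, X̃_t)]`. -/
def termI5 (P : Measure Ω) (K : EuclideanSpace ℝ (Fin (d + 1)) → ℝ)
    (X X' : ℝ → Ω → EuclideanSpace ℝ (Fin d)) (t : ℝ) : ℝ :=
  ∫ ω, K (spaceTime 0 (X 0 ω) - spaceTime t (X' t ω)) ∂P

/-- `I₆(t) = ∫₀ᵗ 𝔼[𝒜^u_s K(0, X_0, s, X̃_s)] ds`. -/
def termI6 (P : Measure Ω) (K : EuclideanSpace ℝ (Fin (d + 1)) → ℝ)
    (u : ℝ → EuclideanSpace ℝ (Fin d) → EuclideanSpace ℝ (Fin d))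
    (X X' : ℝ → Ω → EuclideanSpace ℝ (Fin d)) (t : ℝ) : ℝ :=
  ∫ s in (0 : ℝ)..t, ∫ ω, opKernel K u (spaceTime 0 (X 0 ω)) s (X' s ω) ∂P

/-- All expectations and time integrals in `I₁(t), …, I₆(t)` exist (for the time integrals, the
expectations exist for almost every time, resp. almost every pair of times). -/
structure TermsWellDefined (P : Measure Ω) (K : EuclideanSpace ℝ (Fin (d + 1)) → ℝ)
    (u : ℝ → EuclideanSpace ℝ (Fin d) → EuclideanSpace ℝ (Fin d))
    (X X' : ℝ → Ω → EuclideanSpace ℝ (Fin d)) (t : ℝ) : Prop where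
  expectation1 : ∀ᵐ z ∂(volume.restrict (Set.Icc (0 : ℝ) t ×ˢ Set.Icc (0 : ℝ) t)),
    Integrable (fun ω => opOpKernel K u z.1 (X z.1 ω) z.2 (X' z.2 ω)) P
  integral1 : IntegrableOn
    (fun z : ℝ × ℝ => ∫ ω, opOpKernel K u z.1 (X z.1 ω) z.2 (X' z.2 ω) ∂P)
    (Set.Icc (0 : ℝ) t ×ˢ Set.Icc (0 : ℝ) t)
  expectation2 : Integrable (fun ω => K (spaceTime t (X t ω) - spaceTime t (X' t ω))) P
  expectation3 : Integrable (fun ω => K (spaceTime 0 (X 0 ω) - spaceTime 0 (X' 0 ω))) P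
  expectation4 : ∀ᵐ s ∂(volume.restrict (Set.Icc (0 : ℝ) t)),
    Integrable (fun ω => opKernel K u (spaceTime t (X t ω)) s (X' s ω)) P
  integral4 : IntegrableOn
    (fun s => ∫ ω, opKernel K u (spaceTime t (X t ω)) s (X' s ω) ∂P) (Set.Icc (0 : ℝ) t)
  expectation5 : Integrable (fun ω => K (spaceTime 0 (X 0 ω) - spaceTime t (X' t ω))) P
  expectation6 : ∀ᵐ s ∂(volume.restrict (Set.Icc (0 : ℝ) t)),
    Integrable (fun ω => opKernel K u (spaceTime 0 (X 0 ω)) s (X' s ω)) P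
  integral6 : IntegrableOn
    (fun s => ∫ ω, opKernel K u (spaceTime 0 (X 0 ω)) s (X' s ω) ∂P) (Set.Icc (0 : ℝ) t)

end Terms

end

/-!
Let `Φ ξ = K (· - ξ) ∈ H` be the canonical feature map, so that `⟪Φ ξ, f⟫ = f ξ` and
`⟪Φ ξ, Φ η⟫ = K (ξ - η)`. The residual `H_t^u` is represented by the vector
`h = ∫₀ᵗ w(r) dr - b(t) + b(0)` of `H`, where `b(r) = ∫ p(r, y) Φ(r, y) dy` and
`w(r) = ∫ p(r, y) 𝒜^u Φ(r, y) dy` are Bochner integrals in `H`. Expanding `‖h‖²` gives six inner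
products. As `X` and `X'` are independent with laws `μ_t`, each `𝔼⟪f(X_s), g(X'_r)⟫` equals
`⟪∫ f dμ_s, ∫ g dμ_r⟫` (`integral_inner_of_indepFun`), which identifies the six inner products with
`I₁, …, I₆`.

What has to be justified is that `𝒜^u Φ` makes sense in `H`. By Fourier inversion, the second moment
of `K̂` gives `K ∈ C²` (`contDiff_two_of_integrable_fourier`) and, by dominated convergence, the
convergence of the mixed second difference quotients of `K` at `0`
(`exists_tendsto_second_difference`). The latter are the inner products of difference quotients of
`Φ`, which are therefore Cauchy, so `Φ` is differentiable along every line
(`lineDifferentiableAt_of_tendsto_second_difference`). The Gram kernel of its directional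
derivatives is `-K''`, hence these are bounded and continuous, which makes `p 𝒜^u Φ` integrable
(`integrable_smul_transportFeature`) and gives `𝒜^u K = ⟪Φ, 𝒜^u Φ⟫` and
`𝒜^u 𝒜^u K = ⟪𝒜^u Φ, 𝒜^u Φ⟫` (`opKernel_eq_inner`, `opOpKernel_eq_inner`).
-/

/-! ### Regularity from Fourier moments -/

section Fourier

variable {V : Type*} [NormedAddCommGroup V] [InnerProductSpace ℝ V] [FiniteDimensional ℝ V]
  [MeasurableSpace V] [BorelSpace V]

theorem integrable_pow_mul_norm_of_integrable_one_add_sq {g : V → ℂ}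
    (hg : AEStronglyMeasurable g)
    (hint : Integrable fun z : V => ((1 + ‖z‖ ^ 2 : ℝ) : ℂ) * g z) {n : ℕ} (hn : n ≤ 2) :
    Integrable fun z => ‖z‖ ^ n * ‖g z‖ := by
  refine hint.mono ((continuous_norm.pow n).aestronglyMeasurable.mul hg.norm)
    (ae_of_all _ fun z => ?_)
  have h0 : 0 ≤ ‖z‖ := norm_nonneg z
  have h1 : ‖z‖ ^ n ≤ 1 + ‖z‖ ^ 2 := by
    interval_cases n <;> nlinarith [sq_nonneg (‖z‖ - 1)]
  rw [norm_mul, norm_mul, Complex.norm_real, norm_norm, norm_pow, norm_norm]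
  exact mul_le_mul_of_nonneg_right (h1.trans (le_abs_self _)) (norm_nonneg _)

variable {K : V → ℝ}

theorem continuous_fourier_ofReal (hint : Integrable K) :
    Continuous (𝓕 fun ξ => (K ξ : ℂ)) :=
  VectorFourier.fourierIntegral_continuous Real.continuous_fourierChar
    (by exact continuous_inner) hint.ofReal

/-- Fourier inversion for a real function with integrable Fourier transform. -/
theorem ofReal_eq_integral_fourier (hc : Continuous K) (hint : Integrable K)
    (hF : Integrable (𝓕 fun ξ => (K ξ : ℂ))) (ξ : V) :
    (K ξ : ℂ) = ∫ z, Complex.exp ((2 * Real.pi * inner ℝ z ξ : ℝ) * Complex.I) *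
      𝓕 (fun ξ => (K ξ : ℂ)) z := by
  have h := congrFun ((Complex.continuous_ofReal.comp hc).fourierInv_fourier_eq
    hint.ofReal hF) ξ
  have h' : (K ξ : ℂ) = 𝓕⁻ (𝓕 fun ξ => (K ξ : ℂ)) ξ := h.symm
  rw [h', Real.fourierInv_eq']
  simp only [smul_eq_mul]

theorem contDiff_two_of_integrable_fourier (hc : Continuous K) (hint : Integrable K)
    (hF : Integrable fun z : V => ((1 + ‖z‖ ^ 2 : ℝ) : ℂ) * 𝓕 (fun ξ => (K ξ : ℂ)) z) :
    ContDiff ℝ 2 K := by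
  have hm := (continuous_fourier_ofReal hint).aestronglyMeasurable (μ := volume)
  have hF0 : Integrable (𝓕 fun ξ => (K ξ : ℂ)) := by
    have := integrable_pow_mul_norm_of_integrable_one_add_sq hm hF (n := 0) (by norm_num)
    simp only [pow_zero, one_mul] at this
    exact (integrable_norm_iff hm).1 this
  have h2 : ContDiff ℝ (2 : ℕ∞) (𝓕 (𝓕 fun ξ => (K ξ : ℂ))) :=
    Real.contDiff_fourier fun n hn =>
      integrable_pow_mul_norm_of_integrable_one_add_sq hm hF (by exact_mod_cast hn)
  have hK : K = fun ξ => Complex.reCLM (𝓕 (𝓕 fun ξ => (K ξ : ℂ)) (-ξ)) := by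
    funext ξ
    have h := congrFun ((Complex.continuous_ofReal.comp hc).fourierInv_fourier_eq
      hint.ofReal hF0) ξ
    have h' : (K ξ : ℂ) = 𝓕⁻ (𝓕 fun ξ => (K ξ : ℂ)) ξ := h.symm
    rw [← Real.fourierInv_eq_fourier_neg, ← h']
    simp
  rw [hK]
  exact Complex.reCLM.contDiff.comp (h2.comp contDiff_neg)

theorem tendsto_exp_mul_I_sub_one_div (a : ℝ) :
    Tendsto (fun h : ℝ => (Complex.exp ((h * a : ℝ) * Complex.I) - 1) / h) (𝓝[≠] 0)
      (𝓝 (a * Complex.I)) := by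
  have h1 : HasDerivAt (fun h : ℝ => Complex.exp ((h * a : ℝ) * Complex.I)) (a * Complex.I) 0 := by
    have h2 : HasDerivAt (fun h : ℝ => ((h * a : ℝ) : ℂ) * Complex.I) (a * Complex.I) 0 := by
      have := ((hasDerivAt_id (0 : ℝ)).mul_const a).ofReal_comp.mul_const Complex.I
      simpa using this
    simpa using h2.cexp
  have h3 := hasDerivAt_iff_tendsto_slope_zero.1 h1
  refine h3.congr fun h => ?_
  simp only [zero_add, zero_mul, Complex.ofReal_zero, Complex.exp_zero, Complex.real_smul,
    Complex.ofReal_inv]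
  ring

theorem norm_exp_mul_I_sub_one_div_le (a h : ℝ) :
    ‖(Complex.exp ((h * a : ℝ) * Complex.I) - 1) / h‖ ≤ |a| := by
  have h1 := Real.norm_exp_I_mul_ofReal_sub_one_le (x := h * a)
  rw [norm_div, Complex.norm_real]
  refine div_le_of_le_mul₀ (norm_nonneg _) (abs_nonneg _) ?_
  rw [mul_comm Complex.I] at h1
  simpa [mul_comm] using h1

/-- The mixed second difference quotients of `K` at the origin converge: under the Fourier
integral they have the integrable bound `(2π ⟪z, v⟫)² |K̂(z)|`. -/
theorem exists_tendsto_second_difference (hc : Continuous K) (hint : Integrable K)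
    (hF : Integrable fun z : V => ((1 + ‖z‖ ^ 2 : ℝ) : ℂ) * 𝓕 (fun ξ => (K ξ : ℂ)) z) (v : V) :
    ∃ L : ℝ, Tendsto (fun x : ℝ × ℝ => x.1⁻¹ * x.2⁻¹ *
      (K (x.1 • v - x.2 • v) - K (x.1 • v) - K (-(x.2 • v)) + K 0))
      ((𝓝[≠] 0) ×ˢ (𝓝[≠] 0)) (𝓝 L) := by
  set g : V → ℂ := 𝓕 fun ξ => (K ξ : ℂ)
  have hm : AEStronglyMeasurable g :=
    (continuous_fourier_ofReal hint).aestronglyMeasurable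
  have hF0 : Integrable g := by
    have := integrable_pow_mul_norm_of_integrable_one_add_sq hm hF (n := 0) (by norm_num)
    simp only [pow_zero, one_mul] at this
    exact (integrable_norm_iff hm).1 this
  have hF2 := integrable_pow_mul_norm_of_integrable_one_add_sq hm hF (n := 2) le_rfl
  -- The quotient `e h` tends to `a I` as `h → 0`, and the integrand of the second difference
  -- quotient is `e h * -e (-k) * g`.
  let a : V → ℝ := fun z => 2 * Real.pi * inner ℝ z v
  let e : ℝ → V → ℂ := fun h z => (Complex.exp ((h * a z : ℝ) * Complex.I) - 1) / h
  have ha : Continuous a := by fun_prop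
  have he (h : ℝ) : Continuous (e h) := by fun_prop
  have hlim : Tendsto (fun x : ℝ × ℝ => ∫ z, e x.1 z * -e (-x.2) z * g z)
      ((𝓝[≠] 0) ×ˢ (𝓝[≠] 0)) (𝓝 (∫ z, (a z * Complex.I) * -(a z * Complex.I) * g z)) := by
    refine tendsto_integral_filter_of_dominated_convergence
      (fun z => (2 * Real.pi * ‖v‖) ^ 2 * (‖z‖ ^ 2 * ‖g z‖)) ?_ ?_ (hF2.const_mul _) ?_
    · exact Eventually.of_forall fun x =>
        (((he _).mul (he _).neg).aestronglyMeasurable).mul hm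
    · refine Eventually.of_forall fun x => ae_of_all _ fun z => ?_
      rw [norm_mul, norm_mul, norm_neg]
      have h1 : |a z| ≤ 2 * Real.pi * ‖v‖ * ‖z‖ := by
        have := abs_real_inner_le_norm z v
        have hp := Real.pi_pos
        simp only [a, abs_mul, abs_of_pos hp, abs_two]
        nlinarith
      have h2 := (norm_exp_mul_I_sub_one_div_le (a z) x.1).trans h1
      have h3 := (norm_exp_mul_I_sub_one_div_le (a z) (-x.2)).trans h1
      calc ‖e x.1 z‖ * ‖e (-x.2) z‖ * ‖g z‖
          ≤ (2 * Real.pi * ‖v‖ * ‖z‖) * (2 * Real.pi * ‖v‖ * ‖z‖) * ‖g z‖ := by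
            refine mul_le_mul_of_nonneg_right ?_ (norm_nonneg _)
            exact mul_le_mul h2 h3 (norm_nonneg _) ((abs_nonneg _).trans h1)
        _ = _ := by ring
    · refine ae_of_all _ fun z => ?_
      have h1 := tendsto_exp_mul_I_sub_one_div (a z)
      have hneg : Tendsto (fun h : ℝ => -h) (𝓝[≠] 0) (𝓝[≠] 0) := by
        refine tendsto_nhdsWithin_iff.2 ⟨?_, ?_⟩
        · simpa using (continuous_neg (G := ℝ)).continuousAt.tendsto.mono_left
            (nhdsWithin_le_nhds (a := (0 : ℝ)) (s := {0}ᶜ))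
        · filter_upwards [self_mem_nhdsWithin] with h hh
          simpa using hh
      exact ((h1.comp tendsto_fst).mul ((h1.comp hneg).comp tendsto_snd).neg).mul_const _
  refine ⟨_, ((Complex.continuous_re.tendsto _).comp hlim).congr fun x => ?_⟩
  obtain ⟨h, k⟩ := x
  let G : V → V → ℂ := fun ξ z =>
    Complex.exp ((2 * Real.pi * inner ℝ z ξ : ℝ) * Complex.I) * g z
  have hG : ∀ ξ : V, Integrable (G ξ) := fun ξ => by
    refine hF0.bdd_mul (c := 1) ?_ (ae_of_all _ fun z => ?_)
    · exact Continuous.aestronglyMeasurable (by fun_prop)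
    · rw [Complex.norm_exp_ofReal_mul_I]
  have hinv : ∀ ξ, (K ξ : ℂ) = ∫ z, G ξ z := ofReal_eq_integral_fourier hc hint hF0
  have key : ∫ z, e h z * -e (-k) z * g z = ((h⁻¹ * k⁻¹ *
      (K (h • v - k • v) - K (h • v) - K (-(k • v)) + K 0) : ℝ) : ℂ) := by
    have hs1 : Integrable fun z => G (h • v - k • v) z - G (h • v) z := (hG _).sub (hG _)
    have hs2 : Integrable fun z => G (h • v - k • v) z - G (h • v) z - G (-(k • v)) z :=
      hs1.sub (hG _)
    push_cast
    rw [hinv (h • v - k • v), hinv (h • v), hinv (-(k • v)), hinv 0,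
      ← integral_sub (hG _) (hG _), ← integral_sub hs1 (hG _), ← integral_add hs2 (hG _),
      ← integral_const_mul]
    refine integral_congr_ae (ae_of_all _ fun z => ?_)
    have h1 : Complex.exp ((2 * Real.pi * inner ℝ z (h • v - k • v) : ℝ) * Complex.I) =
        Complex.exp ((h * a z : ℝ) * Complex.I) * Complex.exp ((-k * a z : ℝ) * Complex.I) := by
      rw [← Complex.exp_add, ← add_mul, ← Complex.ofReal_add, inner_sub_right, inner_smul_right,
        inner_smul_right]
      congr 3
      simp only [a]; ring
    have h2 : (2 * Real.pi * inner ℝ z (h • v) : ℝ) = h * a z := by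
      rw [inner_smul_right]; simp only [a]; ring
    have h3 : (2 * Real.pi * inner ℝ z (-(k • v)) : ℝ) = -k * a z := by
      rw [inner_neg_right, inner_smul_right]; simp only [a]; ring
    simp only [h1, h2, h3, e, G, inner_zero_right, mul_zero, Complex.ofReal_zero, zero_mul,
      Complex.exp_zero, Complex.ofReal_neg, div_neg, neg_neg]
    ring
  simp only [Function.comp_apply, key, Complex.ofReal_re]

end Fourier

/-! ### Differentiating the feature map -/

section FeatureMap

variable {H : Type*} [NormedAddCommGroup H] [InnerProductSpace ℝ H]

/-- If the Gram matrix `⟪q x, q y⟫` converges along `l ×ˢ l`, then `q` is Cauchy along `l`. -/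
theorem exists_tendsto_of_tendsto_inner [CompleteSpace H] {ι : Type*} {l : Filter ι} [l.NeBot]
    {q : ι → H} {L : ℝ}
    (hq : Tendsto (fun x : ι × ι => inner ℝ (q x.1) (q x.2)) (l ×ˢ l) (𝓝 L)) :
    ∃ f, Tendsto q l (𝓝 f) := by
  refine cauchy_map_iff_exists_tendsto.1 (cauchy_map_iff.2 ⟨inferInstance, ?_⟩)
  rw [tendsto_uniformity_iff_dist_tendsto_zero]
  have h1 : Tendsto (fun x : ι × ι => inner ℝ (q x.1) (q x.1)) (l ×ˢ l) (𝓝 L) :=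
    hq.comp (tendsto_fst.prodMk tendsto_fst)
  have h2 : Tendsto (fun x : ι × ι => inner ℝ (q x.2) (q x.2)) (l ×ˢ l) (𝓝 L) :=
    hq.comp (tendsto_snd.prodMk tendsto_snd)
  have h3 : Tendsto (fun x : ι × ι => Real.sqrt (inner ℝ (q x.1) (q x.1)
      - 2 * inner ℝ (q x.1) (q x.2) + inner ℝ (q x.2) (q x.2))) (l ×ˢ l) (𝓝 0) := by
    have := ((h1.sub (hq.const_mul 2)).add h2).sqrt
    rwa [show L - 2 * L + L = 0 by ring, Real.sqrt_zero] at this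
  refine h3.congr fun x => ?_
  rw [dist_eq_norm, ← Real.sqrt_sq (norm_nonneg (q x.1 - q x.2)), norm_sub_sq_real,
    real_inner_self_eq_norm_sq, real_inner_self_eq_norm_sq]

variable {V : Type*} [NormedAddCommGroup V]

/-- A map into a Hilbert space whose Gram kernel is `κ (ξ - η)` with `κ` continuous is itself
continuous. -/
theorem continuous_of_inner_eq_sub {Ψ : V → H} {κ : V → ℝ} (hκ : Continuous κ)
    (hΨ : ∀ ξ η, inner ℝ (Ψ ξ) (Ψ η) = κ (ξ - η)) : Continuous Ψ := by
  rw [continuous_iff_continuousAt]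
  intro ξ
  rw [ContinuousAt, tendsto_iff_dist_tendsto_zero]
  have h3 : Tendsto (fun η => Real.sqrt (κ 0 - 2 * κ (η - ξ) + κ 0)) (𝓝 ξ) (𝓝 0) := by
    have : Continuous (fun η => Real.sqrt (κ 0 - 2 * κ (η - ξ) + κ 0)) := by fun_prop
    convert this.tendsto ξ using 2
    rw [sub_self, show κ 0 - 2 * κ 0 + κ 0 = 0 by ring, Real.sqrt_zero]
  refine h3.congr fun η => ?_
  rw [dist_eq_norm, ← Real.sqrt_sq (norm_nonneg (Ψ η - Ψ ξ)), norm_sub_sq_real,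
    ← real_inner_self_eq_norm_sq, ← real_inner_self_eq_norm_sq, hΨ, hΨ, hΨ, sub_self, sub_self]

theorem norm_eq_sqrt_of_inner_eq_sub {Ψ : V → H} {κ : V → ℝ}
    (hΨ : ∀ ξ η, inner ℝ (Ψ ξ) (Ψ η) = κ (ξ - η)) (ξ : V) : ‖Ψ ξ‖ = Real.sqrt (κ 0) := by
  rw [← Real.sqrt_sq (norm_nonneg (Ψ ξ)), ← real_inner_self_eq_norm_sq, hΨ, sub_self]

variable [NormedSpace ℝ V] {Φ : V → H} {K : V → ℝ}

/-- The mixed second difference quotients of `K` at the origin are the inner products of the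
difference quotients of `Φ`, whichever the base point `ξ`. -/
theorem lineDifferentiableAt_of_tendsto_second_difference [CompleteSpace H]
    (hΦ : ∀ ξ η, inner ℝ (Φ ξ) (Φ η) = K (ξ - η)) (ξ v : V) {L : ℝ}
    (hL : Tendsto (fun x : ℝ × ℝ => x.1⁻¹ * x.2⁻¹ *
      (K (x.1 • v - x.2 • v) - K (x.1 • v) - K (-(x.2 • v)) + K 0))
      ((𝓝[≠] 0) ×ˢ (𝓝[≠] 0)) (𝓝 L)) :
    LineDifferentiableAt ℝ Φ ξ v := by
  have : Tendsto (fun x : ℝ × ℝ => inner ℝ (x.1⁻¹ • (Φ (ξ + x.1 • v) - Φ ξ))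
      (x.2⁻¹ • (Φ (ξ + x.2 • v) - Φ ξ))) ((𝓝[≠] 0) ×ˢ (𝓝[≠] 0)) (𝓝 L) := by
    refine hL.congr fun x => ?_
    rw [real_inner_smul_left, real_inner_smul_right, inner_sub_left, inner_sub_right,
      inner_sub_right, hΦ, hΦ, hΦ, hΦ]
    simp only [add_sub_add_left_eq_sub, add_sub_cancel_left, sub_add_cancel_left, sub_self]
    ring
  obtain ⟨D, hD⟩ := exists_tendsto_of_tendsto_inner
    (q := fun h : ℝ => h⁻¹ • (Φ (ξ + h • v) - Φ ξ)) this
  refine HasLineDerivAt.lineDifferentiableAt (f' := D) (hasDerivAt_iff_tendsto_slope_zero.2 ?_)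
  simpa using hD

/-- The vector `lineDeriv ℝ Φ ξ v` represents differentiation at `ξ` in the direction `v`: its inner
product with `f` is the derivative of the function `η ↦ ⟪Φ η, f⟫`. -/
theorem inner_lineDeriv_of_hasFDerivAt {f : H} {ξ v : V} {g : V →L[ℝ] ℝ}
    (hd : LineDifferentiableAt ℝ Φ ξ v)
    (hg : HasFDerivAt (fun η => inner ℝ (Φ η) f) g ξ) :
    inner ℝ (lineDeriv ℝ Φ ξ v) f = g v := by
  have h1 : HasLineDerivAt ℝ (fun η => inner ℝ (Φ η) f) (inner ℝ (lineDeriv ℝ Φ ξ v) f) ξ v := by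
    have h := HasDerivAt.inner ℝ hd.hasLineDerivAt (hasDerivAt_const (0 : ℝ) f)
    simpa using! h
  exact h1.unique (hg.hasLineDerivAt v)

theorem inner_lineDeriv_right
    (hΦ : ∀ ξ η, inner ℝ (Φ ξ) (Φ η) = K (ξ - η)) (hK : ContDiff ℝ 2 K)
    (hd : ∀ ξ v, LineDifferentiableAt ℝ Φ ξ v) (η ξ v : V) :
    inner ℝ (Φ η) (lineDeriv ℝ Φ ξ v) = -fderiv ℝ K (η - ξ) v := by
  rw [real_inner_comm]
  have h : HasFDerivAt (fun ζ => inner ℝ (Φ ζ) (Φ η)) (-fderiv ℝ K (η - ξ)) ξ := by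
    have h1 : HasFDerivAt K (fderiv ℝ K (η - ξ)) (η - ξ) :=
      (hK.differentiable (by norm_num)).differentiableAt.hasFDerivAt
    have h2 := h1.comp ξ ((hasFDerivAt_id ξ).const_sub η)
    have h3 : (fun ζ => inner ℝ (Φ ζ) (Φ η)) = K ∘ fun ζ => η - ζ := by
      funext ζ
      rw [real_inner_comm, hΦ]; rfl
    rw [h3]
    convert! h2 using 1
    ext; simp
  rw [inner_lineDeriv_of_hasFDerivAt (hd ξ v) h]; rfl

theorem hasFDerivAt_inner_lineDeriv
    (hΦ : ∀ ξ η, inner ℝ (Φ ξ) (Φ η) = K (ξ - η)) (hK : ContDiff ℝ 2 K)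
    (hd : ∀ ξ v, LineDifferentiableAt ℝ Φ ξ v) (η ξ v : V) :
    HasFDerivAt (fun ζ => inner ℝ (Φ ζ) (lineDeriv ℝ Φ ξ v))
      (-(fderiv ℝ (fderiv ℝ K) (η - ξ)).flip v) η := by
  have h1 : HasFDerivAt (fderiv ℝ K) (fderiv ℝ (fderiv ℝ K) (η - ξ)) (η - ξ) :=
    ((hK.fderiv_right (m := 1) (by norm_num)).differentiable
      (by norm_num)).differentiableAt.hasFDerivAt
  have h2 := (h1.comp η ((hasFDerivAt_id η).sub_const ξ)).clm_apply (hasFDerivAt_const v η)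
  simp_rw [inner_lineDeriv_right hΦ hK hd]
  convert! h2.neg using 1
  ext; simp

theorem inner_lineDeriv_lineDeriv
    (hΦ : ∀ ξ η, inner ℝ (Φ ξ) (Φ η) = K (ξ - η)) (hK : ContDiff ℝ 2 K)
    (hd : ∀ ξ v, LineDifferentiableAt ℝ Φ ξ v) (η w ξ v : V) :
    inner ℝ (lineDeriv ℝ Φ η w) (lineDeriv ℝ Φ ξ v) = -fderiv ℝ (fderiv ℝ K) (η - ξ) w v := by
  rw [inner_lineDeriv_of_hasFDerivAt (hd η w) (hasFDerivAt_inner_lineDeriv hΦ hK hd η ξ v)]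
  rfl

theorem continuous_lineDeriv_feature
    (hΦ : ∀ ξ η, inner ℝ (Φ ξ) (Φ η) = K (ξ - η)) (hK : ContDiff ℝ 2 K)
    (hd : ∀ ξ v, LineDifferentiableAt ℝ Φ ξ v) (v : V) : Continuous fun ξ => lineDeriv ℝ Φ ξ v := by
  refine continuous_of_inner_eq_sub (κ := fun ζ => -fderiv ℝ (fderiv ℝ K) ζ v v) ?_
    fun ξ η => inner_lineDeriv_lineDeriv hΦ hK hd ξ v η v
  have : Continuous (fderiv ℝ (fderiv ℝ K)) :=
    (hK.fderiv_right (m := 1) (by norm_num)).continuous_fderiv (by norm_num)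
  fun_prop

/-- `Φ` is only known to be differentiable along lines; linearity in the direction is inherited from
`fderiv ℝ K`, since the values of `Φ` separate the points of `H`. -/
theorem lineDeriv_sum_smul
    (hΦ : ∀ ξ η, inner ℝ (Φ ξ) (Φ η) = K (ξ - η)) (hK : ContDiff ℝ 2 K)
    (hd : ∀ ξ v, LineDifferentiableAt ℝ Φ ξ v)
    (hinj : ∀ f g : H, (∀ η, inner ℝ (Φ η) f = inner ℝ (Φ η) g) → f = g)
    {ι : Type*} (s : Finset ι) (c : ι → ℝ) (b : ι → V) (ξ : V) :
    lineDeriv ℝ Φ ξ (∑ i ∈ s, c i • b i) = ∑ i ∈ s, c i • lineDeriv ℝ Φ ξ (b i) := by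
  refine hinj _ _ fun η => ?_
  simp_rw [inner_sum, inner_smul_right, inner_lineDeriv_right hΦ hK hd, map_sum, map_smul]
  simp

end FeatureMap

/-! ### The transport operator on the feature map -/

section Transport

variable {d : ℕ}

/-- `(t, x) ↦ spaceTime t x` as a continuous linear map. -/
noncomputable def spaceTimeCLM (d : ℕ) :
    ℝ × EuclideanSpace ℝ (Fin d) →L[ℝ] EuclideanSpace ℝ (Fin (d + 1)) :=
  LinearMap.toContinuousLinearMap
    { toFun := fun z => spaceTime z.1 z.2
      map_add' := fun z w => by
        ext i
        refine Fin.cases ?_ (fun j => ?_) i <;> simp [spaceTime]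
      map_smul' := fun c z => by
        ext i
        refine Fin.cases ?_ (fun j => ?_) i <;> simp [spaceTime] }

theorem spaceTimeCLM_apply (t : ℝ) (x : EuclideanSpace ℝ (Fin d)) :
    spaceTimeCLM d (t, x) = spaceTime t x := rfl

theorem continuous_spaceTime :
    Continuous fun z : ℝ × EuclideanSpace ℝ (Fin d) => spaceTime z.1 z.2 :=
  (spaceTimeCLM d).continuous

theorem spaceTime_eq_sum (t : ℝ) (x : EuclideanSpace ℝ (Fin d)) :
    spaceTime t x = ∑ i, spaceTime t x i • EuclideanSpace.single i (1 : ℝ) := by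
  have h := (EuclideanSpace.basisFun (Fin (d + 1)) ℝ).sum_repr (spaceTime t x)
  simpa using h.symm

/-- `𝒜^u` acting on a function of the space-time variable is the derivative in the space-time
direction `(1, u)`. -/
theorem transportOp_comp_spaceTime (u : ℝ → EuclideanSpace ℝ (Fin d) → EuclideanSpace ℝ (Fin d))
    {F : EuclideanSpace ℝ (Fin (d + 1)) → ℝ} {t : ℝ} {x : EuclideanSpace ℝ (Fin d)}
    {F' : EuclideanSpace ℝ (Fin (d + 1)) →L[ℝ] ℝ} (hF : HasFDerivAt F F' (spaceTime t x)) :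
    transportOp u (fun s y => F (spaceTime s y)) t x = F' (spaceTime 1 (u t x)) := by
  have hF2 : HasFDerivAt (fun z : ℝ × EuclideanSpace ℝ (Fin d) => F (spaceTime z.1 z.2))
      (F' ∘L spaceTimeCLM d) (t, x) :=
    HasFDerivAt.comp (f := spaceTimeCLM d) (t, x) hF (spaceTimeCLM d).hasFDerivAt
  have h1 : HasDerivAt (fun s => F (spaceTime s x)) (F' (spaceTime 1 0)) t := by
    have h := HasFDerivAt.comp_hasDerivAt (f := fun s : ℝ => (s, x)) t hF2
      ((hasDerivAt_id t).prodMk (hasDerivAt_const t x))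
    exact h
  have h2 : HasFDerivAt (fun y => F (spaceTime t y))
      ((F' ∘L spaceTimeCLM d) ∘L ContinuousLinearMap.inr ℝ ℝ (EuclideanSpace ℝ (Fin d))) x :=
    HasFDerivAt.comp (f := fun y => (t, y)) x hF2 (hasFDerivAt_prodMk_right t x)
  have h3 : inner ℝ (u t x) (gradient (fun y => F (spaceTime t y)) x)
      = F' (spaceTime 0 (u t x)) := by
    rw [real_inner_comm, gradient, InnerProductSpace.toDual_symm_apply, h2.fderiv]
    rfl
  rw [transportOp, h1.deriv, h3, ← map_add, ← spaceTimeCLM_apply, ← spaceTimeCLM_apply,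
    ← map_add, ← spaceTimeCLM_apply]
  simp

variable {H : Type*} [NormedAddCommGroup H] [InnerProductSpace ℝ H]
  {Φ : EuclideanSpace ℝ (Fin (d + 1)) → H} {K : EuclideanSpace ℝ (Fin (d + 1)) → ℝ}

/-- The `H`-valued field `𝒜^u Φ`: the derivative of the feature map `Φ` at `(r, y)` in the
direction `(1, u(r, y))`. -/
noncomputable def transportFeature (Φ : EuclideanSpace ℝ (Fin (d + 1)) → H)
    (u : ℝ → EuclideanSpace ℝ (Fin d) → EuclideanSpace ℝ (Fin d)) (r : ℝ)
    (y : EuclideanSpace ℝ (Fin d)) : H :=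
  lineDeriv ℝ Φ (spaceTime r y) (spaceTime 1 (u r y))

theorem opKernel_eq_inner (hΦ : ∀ ξ η, inner ℝ (Φ ξ) (Φ η) = K (ξ - η)) (hK : ContDiff ℝ 2 K)
    (hd : ∀ ξ v, LineDifferentiableAt ℝ Φ ξ v)
    (u : ℝ → EuclideanSpace ℝ (Fin d) → EuclideanSpace ℝ (Fin d))
    (ξ : EuclideanSpace ℝ (Fin (d + 1))) (r : ℝ) (y : EuclideanSpace ℝ (Fin d)) :
    opKernel K u ξ r y = inner ℝ (Φ ξ) (transportFeature Φ u r y) := by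
  have h1 : HasFDerivAt K (fderiv ℝ K (ξ - spaceTime r y)) (ξ - spaceTime r y) :=
    (hK.differentiable (by norm_num)).differentiableAt.hasFDerivAt
  have h2 := h1.comp (spaceTime r y) ((hasFDerivAt_id (spaceTime r y)).const_sub ξ)
  rw [transportFeature, inner_lineDeriv_right hΦ hK hd]
  refine (transportOp_comp_spaceTime u h2).trans ?_
  simp

theorem opOpKernel_eq_inner (hΦ : ∀ ξ η, inner ℝ (Φ ξ) (Φ η) = K (ξ - η)) (hK : ContDiff ℝ 2 K)
    (hd : ∀ ξ v, LineDifferentiableAt ℝ Φ ξ v)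
    (u : ℝ → EuclideanSpace ℝ (Fin d) → EuclideanSpace ℝ (Fin d))
    (s : ℝ) (x : EuclideanSpace ℝ (Fin d)) (r : ℝ) (y : EuclideanSpace ℝ (Fin d)) :
    opOpKernel K u s x r y = inner ℝ (transportFeature Φ u s x) (transportFeature Φ u r y) := by
  have h := hasFDerivAt_inner_lineDeriv hΦ hK hd (spaceTime s x) (spaceTime r y)
    (spaceTime 1 (u r y))
  simp_rw [opOpKernel, opKernel_eq_inner hΦ hK hd]
  refine (transportOp_comp_spaceTime u h).trans ?_
  rw [← inner_lineDeriv_of_hasFDerivAt (hd _ _) h]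
  rfl

theorem transportFeature_eq_sum (hΦ : ∀ ξ η, inner ℝ (Φ ξ) (Φ η) = K (ξ - η))
    (hK : ContDiff ℝ 2 K) (hd : ∀ ξ v, LineDifferentiableAt ℝ Φ ξ v)
    (hinj : ∀ f g : H, (∀ η, inner ℝ (Φ η) f = inner ℝ (Φ η) g) → f = g)
    (u : ℝ → EuclideanSpace ℝ (Fin d) → EuclideanSpace ℝ (Fin d)) (r : ℝ)
    (y : EuclideanSpace ℝ (Fin d)) :
    transportFeature Φ u r y = ∑ i, spaceTime 1 (u r y) i •
      lineDeriv ℝ Φ (spaceTime r y) (EuclideanSpace.single i (1 : ℝ)) := by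
  rw [← lineDeriv_sum_smul hΦ hK hd hinj, ← spaceTime_eq_sum, transportFeature]

end Transport

/-! ### Integration against the marginal flow -/

section Slab

variable {d : ℕ} {T : ℝ} {p : ℝ → EuclideanSpace ℝ (Fin d) → ℝ}

theorem slabMeasure_eq_prod (d : ℕ) (t : ℝ) :
    slabMeasure d t = (volume.restrict (Set.Icc (0 : ℝ) t)).prod
      (volume : Measure (EuclideanSpace ℝ (Fin d))) := by
  rw [slabMeasure, Measure.volume_eq_prod, ← Measure.prod_restrict, Measure.restrict_univ]

theorem slabMeasure_mono {s t : ℝ} (h : s ≤ t) : slabMeasure d s ≤ slabMeasure d t :=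
  Measure.restrict_mono (Set.prod_mono (Set.Icc_subset_Icc_right h) subset_rfl) le_rfl

/-- The slicewise bounds `p t ≥ 0` a.e. combine to a bound a.e. on the slab; Fubini is applied to a
measurable representative, as `{p ≥ 0}` itself need not be measurable. -/
theorem AssumptionA3.ae_slab_nonneg (h : AssumptionA3 T p) :
    ∀ᵐ z ∂slabMeasure d T, 0 ≤ p z.1 z.2 := by
  obtain ⟨p', hm, he⟩ := h.memLp_top.aestronglyMeasurable
  have hmk : ∀ᵐ z ∂slabMeasure d T, 0 ≤ p' z := by
    rw [slabMeasure_eq_prod] at he ⊢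
    refine (Measure.ae_prod_iff_ae_ae
      (measurableSet_le measurable_const hm.measurable)).2 ?_
    filter_upwards [Measure.ae_ae_of_ae_prod he, ae_restrict_mem measurableSet_Icc] with t h1 ht
    filter_upwards [h1, h.nonneg t ht] with x h2 h3
    exact h2 ▸ h3
  filter_upwards [hmk, he] with z h1 h2
  rw [h2]; exact h1

theorem AssumptionA3.integral_norm_eq_one (h : AssumptionA3 T p) {t : ℝ}
    (ht : t ∈ Set.Icc (0 : ℝ) T) : ∫ x, ‖p t x‖ = 1 := by
  rw [← h.integral_eq_one t ht]
  refine integral_congr_ae ?_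
  filter_upwards [h.nonneg t ht] with x hx
  exact Real.norm_of_nonneg hx

theorem AssumptionA3.integrable_slab (h : AssumptionA3 T p) :
    Integrable (fun z : ℝ × EuclideanSpace ℝ (Fin d) => p z.1 z.2) (slabMeasure d T) := by
  have hm := h.memLp_top.aestronglyMeasurable
  rw [slabMeasure_eq_prod] at hm ⊢
  refine (integrable_prod_iff hm).2 ⟨?_, ?_⟩
  · filter_upwards [ae_restrict_mem measurableSet_Icc] with t ht using h.integrable t ht
  · refine (integrable_const (1 : ℝ)).congr ?_
    filter_upwards [ae_restrict_mem measurableSet_Icc] with t ht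
    exact (h.integral_norm_eq_one ht).symm

theorem VelocityL1.integrable_smul {u : ℝ → EuclideanSpace ℝ (Fin d) → EuclideanSpace ℝ (Fin d)}
    (hu : VelocityL1 T p u) (h : AssumptionA3 T p) :
    Integrable (fun z : ℝ × EuclideanSpace ℝ (Fin d) => p z.1 z.2 • u z.1 z.2)
      (slabMeasure d T) := by
  have h1 := (integrable_withDensity_iff_integrable_smul₀'
    h.memLp_top.aestronglyMeasurable.aemeasurable.ennreal_ofReal
    (ae_of_all _ fun _ => ENNReal.ofReal_lt_top)).1 hu
  refine h1.congr ?_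
  filter_upwards [h.ae_slab_nonneg] with z hz
  rw [ENNReal.toReal_ofReal hz]

variable {F : Type*} [NormedAddCommGroup F] [NormedSpace ℝ F]

theorem AssumptionA3.integrable_marginalLaw_iff (h : AssumptionA3 T p) {t : ℝ}
    (ht : t ∈ Set.Icc (0 : ℝ) T) {f : EuclideanSpace ℝ (Fin d) → F} :
    Integrable f (marginalLaw p t) ↔ Integrable fun x => p t x • f x := by
  rw [marginalLaw, integrable_withDensity_iff_integrable_smul₀'
    (h.integrable t ht).aemeasurable.ennreal_ofReal (ae_of_all _ fun _ => ENNReal.ofReal_lt_top)]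
  refine integrable_congr ?_
  filter_upwards [h.nonneg t ht] with x hx
  rw [ENNReal.toReal_ofReal hx]

theorem AssumptionA3.integral_marginalLaw (h : AssumptionA3 T p) {t : ℝ}
    (ht : t ∈ Set.Icc (0 : ℝ) T) (f : EuclideanSpace ℝ (Fin d) → F) :
    ∫ x, f x ∂marginalLaw p t = ∫ x, p t x • f x := by
  rw [marginalLaw, integral_withDensity_eq_integral_toReal_smul₀
    (h.integrable t ht).aemeasurable.ennreal_ofReal (ae_of_all _ fun _ => ENNReal.ofReal_lt_top)]
  refine integral_congr_ae ?_
  filter_upwards [h.nonneg t ht] with x hx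
  rw [ENNReal.toReal_ofReal hx]

variable {H : Type*} [NormedAddCommGroup H] [InnerProductSpace ℝ H]
  {Φ : EuclideanSpace ℝ (Fin (d + 1)) → H} {K : EuclideanSpace ℝ (Fin (d + 1)) → ℝ}

/-- The density-weighted field `p 𝒜^u Φ` is Bochner integrable over the slab: in coordinates it is
a sum of integrable scalars times bounded continuous `H`-valued partial derivatives of `Φ`. -/
theorem integrable_smul_transportFeature (hΦ : ∀ ξ η, inner ℝ (Φ ξ) (Φ η) = K (ξ - η))
    (hK : ContDiff ℝ 2 K) (hd : ∀ ξ v, LineDifferentiableAt ℝ Φ ξ v)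
    (hinj : ∀ f g : H, (∀ η, inner ℝ (Φ η) f = inner ℝ (Φ η) g) → f = g)
    (h : AssumptionA3 T p) {u : ℝ → EuclideanSpace ℝ (Fin d) → EuclideanSpace ℝ (Fin d)}
    (hu : VelocityL1 T p u) :
    Integrable (fun z : ℝ × EuclideanSpace ℝ (Fin d) =>
      p z.1 z.2 • transportFeature Φ u z.1 z.2) (slabMeasure d T) := by
  simp_rw [transportFeature_eq_sum hΦ hK hd hinj, Finset.smul_sum, smul_smul]
  refine integrable_finsetSum _ fun i _ => ?_
  have hc : Integrable (fun z : ℝ × EuclideanSpace ℝ (Fin d) =>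
      p z.1 z.2 * spaceTime 1 (u z.1 z.2) i) (slabMeasure d T) := by
    refine Fin.cases ?_ (fun j => ?_) i
    · simpa [spaceTime] using h.integrable_slab
    · have := (EuclideanSpace.proj (𝕜 := ℝ) j).integrable_comp (hu.integrable_smul h)
      simpa [spaceTime] using this
  refine hc.smul_bdd (C := Real.sqrt (-fderiv ℝ (fderiv ℝ K) 0 (EuclideanSpace.single i 1)
    (EuclideanSpace.single i 1))) ?_ (ae_of_all _ fun z => le_of_eq ?_)
  · exact ((continuous_lineDeriv_feature hΦ hK hd _).comp
      continuous_spaceTime).aestronglyMeasurable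
  · exact norm_eq_sqrt_of_inner_eq_sub
      (κ := fun ζ => -fderiv ℝ (fderiv ℝ K) ζ (EuclideanSpace.single i 1)
        (EuclideanSpace.single i 1))
      (fun ξ η => inner_lineDeriv_lineDeriv hΦ hK hd ξ _ η _) _

theorem integrable_smul_feature (hΦ : ∀ ξ η, inner ℝ (Φ ξ) (Φ η) = K (ξ - η))
    (hK : Continuous K) (h : AssumptionA3 T p) {t : ℝ} (ht : t ∈ Set.Icc (0 : ℝ) T) :
    Integrable (fun y => p t y • Φ (spaceTime t y)) := by
  refine (h.integrable t ht).smul_bdd (C := Real.sqrt (K 0)) ?_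
    (ae_of_all _ fun z => (norm_eq_sqrt_of_inner_eq_sub hΦ _).le)
  exact ((continuous_of_inner_eq_sub hK hΦ).comp
    (continuous_spaceTime.comp (Continuous.prodMk_right t))).aestronglyMeasurable

end Slab

/-! ### Expectations of inner products of independent variables -/

section Independence

theorem integrable_inner_prod {E E' H : Type*} [MeasurableSpace E] [MeasurableSpace E']
    [NormedAddCommGroup H] [InnerProductSpace ℝ H] {μ : Measure E} {ν : Measure E'} [SFinite ν]
    {f : E → H} {g : E' → H} (hf : Integrable f μ) (hg : Integrable g ν) :
    Integrable (fun z : E × E' => inner ℝ (f z.1) (g z.2)) (μ.prod ν) :=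
  hf.op_fst_snd (op := fun a b => inner ℝ a b) continuous_inner
    ⟨1, fun a b => by simpa using norm_inner_le_norm (𝕜 := ℝ) a b⟩ hg

variable {Ω E E' H : Type*} [MeasurableSpace Ω] [MeasurableSpace E] [MeasurableSpace E']
  [NormedAddCommGroup H] [InnerProductSpace ℝ H] {P : Measure Ω} [IsProbabilityMeasure P]
  {X : Ω → E} {Y : Ω → E'} {μ : Measure E} {ν : Measure E'} {f : E → H} {g : E' → H}

theorem integrable_inner_of_indepFun (hX : HasLaw X μ P) (hY : HasLaw Y ν P)
    (hXY : IndepFun X Y P) (hf : Integrable f μ) (hg : Integrable g ν) :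
    Integrable (fun ω => inner ℝ (f (X ω)) (g (Y ω))) P := by
  have hmap := (indepFun_iff_map_prod_eq_prod_map_map hX.aemeasurable hY.aemeasurable).1 hXY
  rw [hX.map_eq, hY.map_eq] at hmap
  have : IsFiniteMeasure μ := hX.map_eq ▸ inferInstance
  have : IsFiniteMeasure ν := hY.map_eq ▸ inferInstance
  have hI := integrable_inner_prod hf hg
  rw [← hmap] at hI
  exact hI.comp_aemeasurable (hX.aemeasurable.prodMk hY.aemeasurable)

/-- For independent `X` and `Y`, `𝔼⟪f(X), g(Y)⟫ = ⟪𝔼 f(X), 𝔼 g(Y)⟫`. -/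
theorem integral_inner_of_indepFun [CompleteSpace H] (hX : HasLaw X μ P) (hY : HasLaw Y ν P)
    (hXY : IndepFun X Y P) (hf : Integrable f μ) (hg : Integrable g ν) :
    ∫ ω, inner ℝ (f (X ω)) (g (Y ω)) ∂P = inner ℝ (∫ x, f x ∂μ) (∫ y, g y ∂ν) := by
  have hmap := (indepFun_iff_map_prod_eq_prod_map_map hX.aemeasurable hY.aemeasurable).1 hXY
  rw [hX.map_eq, hY.map_eq] at hmap
  have : IsFiniteMeasure μ := hX.map_eq ▸ inferInstance
  have : IsFiniteMeasure ν := hY.map_eq ▸ inferInstance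
  have hI := integrable_inner_prod hf hg
  have h1 : ∫ z, inner ℝ (f z.1) (g z.2) ∂(μ.prod ν) =
      ∫ ω, inner ℝ (f (X ω)) (g (Y ω)) ∂P := by
    rw [← hmap] at hI ⊢
    exact integral_map (hX.aemeasurable.prodMk hY.aemeasurable) hI.aestronglyMeasurable
  rw [← h1, integral_prod _ hI]
  simp_rw [integral_inner hg]
  simp_rw [real_inner_comm (∫ y, g y ∂ν)]
  rw [integral_inner hf]

end Independence

/-! ### The squared norm of the residual -/

section Expansion

variable {H : Type*} [NormedAddCommGroup H] [InnerProductSpace ℝ H]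

theorem inner_reproducing [CompleteSpace H] {V : Type*} [RKHS ℝ H V ℝ] (ξ : V) (f : H) :
    inner ℝ (RKHS.kerFun H ξ (1 : ℝ)) f = f ξ := by
  simp

theorem norm_sub_add_sq (g b c : H) :
    ‖g - b + c‖ ^ 2 = inner ℝ g g + inner ℝ b b + inner ℝ c c
      - 2 * inner ℝ b g - 2 * inner ℝ c b + 2 * inner ℝ c g := by
  rw [← real_inner_self_eq_norm_sq]
  simp only [inner_add_left, inner_add_right, inner_sub_left, inner_sub_right,
    real_inner_comm g b, real_inner_comm b c, real_inner_comm g c]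
  ring

theorem integral_integral_inner [CompleteSpace H] {α : Type*} [MeasurableSpace α] {m : Measure α}
    {w : α → H} (hw : Integrable w m) :
    ∫ r, ∫ s, inner ℝ (w s) (w r) ∂m ∂m = inner ℝ (∫ r, w r ∂m) (∫ r, w r ∂m) := by
  have h : ∀ r, ∫ s, inner ℝ (w s) (w r) ∂m = inner ℝ (∫ r, w r ∂m) (w r) := fun r => by
    rw [real_inner_comm, ← integral_inner hw]
    exact integral_congr_ae (ae_of_all _ fun s => real_inner_comm _ _)
  simp_rw [h]
  exact integral_inner hw _

end Expansion

theorem mainTheorem4 {d : ℕ} {T : ℝ}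
    (K : EuclideanSpace ℝ (Fin (d + 1)) → ℝ)
    {H : Type*} [NormedAddCommGroup H] [InnerProductSpace ℝ H] [CompleteSpace H]
    [RKHS ℝ H (EuclideanSpace ℝ (Fin (d + 1))) ℝ]
    (hH : RKHS.kernel H = translationKernel K)
    (p : ℝ → EuclideanSpace ℝ (Fin d) → ℝ)
    (hA1 : AssumptionA1 T K H) (hA2 : AssumptionA2 K) (hA3 : AssumptionA3 T p)
    (u : ℝ → EuclideanSpace ℝ (Fin d) → EuclideanSpace ℝ (Fin d))
    (hu : VelocityL1 T p u)
    {Ω : Type*} [MeasurableSpace Ω] (P : Measure Ω) [IsProbabilityMeasure P]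
    (X X' : ℝ → Ω → EuclideanSpace ℝ (Fin d))
    (hXcont : ∀ᵐ ω ∂P, ContinuousOn (fun t => X t ω) (Set.Icc 0 T))
    (hXcont' : ∀ᵐ ω ∂P, ContinuousOn (fun t => X' t ω) (Set.Icc 0 T))
    (hXlaw : ∀ t ∈ Set.Icc (0 : ℝ) T, HasLaw (X t) (marginalLaw p t) P)
    (hXlaw' : ∀ t ∈ Set.Icc (0 : ℝ) T, HasLaw (X' t) (marginalLaw p t) P)
    (hindep : IndepFun (fun ω (t : Set.Icc (0 : ℝ) T) => X t ω)
      (fun ω (t : Set.Icc (0 : ℝ) T) => X' t ω) P)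
    (t : ℝ) (ht : t ∈ Set.Icc (0 : ℝ) T) :
    ResidualWellDefined K p u t ∧ TermsWellDefined P K u X X' t ∧
      ∃ h : H, (∀ ξ, h ξ = residualFun K p u t ξ) ∧
        ‖h‖ ^ 2 = termI1 P K u X X' t + termI2 P K X X' t + termI3 P K X X'
          - 2 * termI4 P K u X X' t - 2 * termI5 P K X X' t + 2 * termI6 P K u X X' t := by
  have ht0 : (0 : ℝ) ∈ Set.Icc (0 : ℝ) T := ⟨le_rfl, ht.1.trans ht.2⟩
  have hK : ContDiff ℝ 2 K :=
    contDiff_two_of_integrable_fourier hA1.continuous hA1.integrable hA2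
  obtain ⟨Φ, hΦdef⟩ : ∃ Φ : EuclideanSpace ℝ (Fin (d + 1)) → H,
    Φ = fun ξ => RKHS.kerFun H ξ (1 : ℝ) := ⟨_, rfl⟩
  have hrep : ∀ ξ (f : H), inner ℝ (Φ ξ) f = f ξ := fun ξ f => by
    rw [hΦdef]; exact inner_reproducing ξ f
  have hΦ : ∀ ξ η, inner ℝ (Φ ξ) (Φ η) = K (ξ - η) := fun ξ η => by
    rw [hrep, hΦdef, RKHS.kerFun_apply, hH]
    simp [translationKernel]
  have hd : ∀ ξ v, LineDifferentiableAt ℝ Φ ξ v := fun ξ v => by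
    obtain ⟨L, hL⟩ := exists_tendsto_second_difference hA1.continuous hA1.integrable hA2 v
    exact lineDifferentiableAt_of_tendsto_second_difference hΦ ξ v hL
  have hinj : ∀ f g : H, (∀ η, inner ℝ (Φ η) f = inner ℝ (Φ η) g) → f = g := fun f g hfg =>
    RKHS.ext fun η => by rw [← hrep, ← hrep, hfg]
  let W := transportFeature Φ u
  let m : Measure ℝ := volume.restrict (Set.Icc (0 : ℝ) t)
  let w : ℝ → H := fun r => ∫ y, p r y • W r y
  let b : ℝ → H := fun r => ∫ y, p r y • Φ (spaceTime r y)
  have hop : ∀ ξ r y, opKernel K u ξ r y = inner ℝ (Φ ξ) (W r y) :=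
    opKernel_eq_inner hΦ hK hd u
  have hopop : ∀ s x r y, opOpKernel K u s x r y = inner ℝ (W s x) (W r y) :=
    opOpKernel_eq_inner hΦ hK hd u
  have hW : Integrable (fun z : ℝ × EuclideanSpace ℝ (Fin d) => p z.1 z.2 • W z.1 z.2)
      (slabMeasure d t) :=
    (integrable_smul_transportFeature hΦ hK hd hinj hA3 hu).mono_measure (slabMeasure_mono ht.2)
  have hW' := hW
  rw [slabMeasure_eq_prod] at hW'
  have hw : Integrable w m := hW'.integral_prod_left
  have hΦp : ∀ r ∈ Set.Icc (0 : ℝ) T, Integrable fun y => p r y • Φ (spaceTime r y) :=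
    fun r hr => integrable_smul_feature hΦ hA1.continuous hA3 hr
  have hΦlaw : ∀ r ∈ Set.Icc (0 : ℝ) T,
      Integrable (fun y => Φ (spaceTime r y)) (marginalLaw p r) :=
    fun r hr => (hA3.integrable_marginalLaw_iff hr).2 (hΦp r hr)
  -- `u` is only defined almost everywhere, so `W r` is `μ_r`-integrable only for almost every `r`.
  have hWlaw : ∀ᵐ r ∂m, r ∈ Set.Icc (0 : ℝ) T ∧ Integrable (W r) (marginalLaw p r) := by
    filter_upwards [hW'.prod_right_ae, ae_restrict_mem measurableSet_Icc] with r h1 hr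
    have hrT : r ∈ Set.Icc (0 : ℝ) T := ⟨hr.1, hr.2.trans ht.2⟩
    exact ⟨hrT, (hA3.integrable_marginalLaw_iff hrT).2 h1⟩
  -- Independence turns the expectation of an inner product into an inner product of means.
  have hE : ∀ s ∈ Set.Icc (0 : ℝ) T, ∀ r ∈ Set.Icc (0 : ℝ) T,
      ∀ f g : EuclideanSpace ℝ (Fin d) → H, Integrable f (marginalLaw p s) →
      Integrable g (marginalLaw p r) →
      Integrable (fun ω => inner ℝ (f (X s ω)) (g (X' r ω))) P ∧
      ∫ ω, inner ℝ (f (X s ω)) (g (X' r ω)) ∂P =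
        inner ℝ (∫ y, p s y • f y) (∫ y, p r y • g y) := by
    intro s hs r hr f g hf hg
    have hi : IndepFun (X s) (X' r) P :=
      hindep.comp (measurable_pi_apply (⟨s, hs⟩ : Set.Icc (0 : ℝ) T))
        (measurable_pi_apply (⟨r, hr⟩ : Set.Icc (0 : ℝ) T))
    rw [← hA3.integral_marginalLaw hs, ← hA3.integral_marginalLaw hr]
    exact ⟨integrable_inner_of_indepFun (hXlaw s hs) (hXlaw' r hr) hi hf hg,
      integral_inner_of_indepFun (hXlaw s hs) (hXlaw' r hr) hi hf hg⟩
  have hΦΦ : ∀ s ∈ Set.Icc (0 : ℝ) T, ∀ r ∈ Set.Icc (0 : ℝ) T,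
      Integrable (fun ω => K (spaceTime s (X s ω) - spaceTime r (X' r ω))) P ∧
      ∫ ω, K (spaceTime s (X s ω) - spaceTime r (X' r ω)) ∂P = inner ℝ (b s) (b r) := by
    intro s hs r hr
    simp_rw [← hΦ]
    exact hE s hs r hr _ _ (hΦlaw s hs) (hΦlaw r hr)
  have hΦW : ∀ s ∈ Set.Icc (0 : ℝ) T, ∀ᵐ r ∂m,
      Integrable (fun ω => opKernel K u (spaceTime s (X s ω)) r (X' r ω)) P ∧
      ∫ ω, opKernel K u (spaceTime s (X s ω)) r (X' r ω) ∂P = inner ℝ (b s) (w r) := by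
    intro s hs
    filter_upwards [hWlaw] with r hr
    simp_rw [hop]
    exact hE s hs r hr.1 _ _ (hΦlaw s hs) hr.2
  have hWW : ∀ s r, (s ∈ Set.Icc (0 : ℝ) T ∧ Integrable (W s) (marginalLaw p s)) →
      (r ∈ Set.Icc (0 : ℝ) T ∧ Integrable (W r) (marginalLaw p r)) →
      Integrable (fun ω => opOpKernel K u s (X s ω) r (X' r ω)) P ∧
      ∫ ω, opOpKernel K u s (X s ω) r (X' r ω) ∂P = inner ℝ (w s) (w r) := by
    intro s r hs hr
    simp_rw [hopop]
    exact hE s hs.1 r hr.1 _ _ hs.2 hr.2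
  have hWWae : ∀ᵐ z ∂m.prod m,
      Integrable (fun ω => opOpKernel K u z.1 (X z.1 ω) z.2 (X' z.2 ω)) P ∧
      ∫ ω, opOpKernel K u z.1 (X z.1 ω) z.2 (X' z.2 ω) ∂P = inner ℝ (w z.1) (w z.2) := by
    filter_upwards [Measure.quasiMeasurePreserving_fst.ae hWlaw,
      Measure.quasiMeasurePreserving_snd.ae hWlaw] with z h1 h2
    exact hWW z.1 z.2 h1 h2
  have hmm : (volume.restrict (Set.Icc (0 : ℝ) t ×ˢ Set.Icc (0 : ℝ) t) : Measure (ℝ × ℝ)) =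
      m.prod m := by
    rw [Measure.volume_eq_prod, ← Measure.prod_restrict]
  have hint : ∀ f : ℝ → ℝ, ∫ r in (0 : ℝ)..t, f r = ∫ r, f r ∂m := fun f => by
    rw [intervalIntegral.integral_of_le ht.1, ← integral_Icc_eq_integral_Ioc]
  have hbw : ∀ s ∈ Set.Icc (0 : ℝ) T,
      ∫ r in (0 : ℝ)..t, ∫ ω, opKernel K u (spaceTime s (X s ω)) r (X' r ω) ∂P =
        inner ℝ (b s) (∫ r, w r ∂m) := fun s hs => by
    rw [hint, ← integral_inner hw]
    exact integral_congr_ae ((hΦW s hs).mono fun r hr => hr.2)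
  have hbwint : ∀ s ∈ Set.Icc (0 : ℝ) T, Integrable
      (fun r => ∫ ω, opKernel K u (spaceTime s (X s ω)) r (X' r ω) ∂P) m := fun s hs =>
    (hw.const_inner (b s)).congr ((hΦW s hs).mono fun r hr => hr.2.symm)
  have hterm : ∀ r ∈ Set.Icc (0 : ℝ) T, ∀ ξ,
      Integrable (fun y => p r y * K (ξ - spaceTime r y)) := fun r hr ξ => by
    simp_rw [← hΦ, ← real_inner_smul_right]
    exact (hΦp r hr).const_inner (Φ ξ)
  refine ⟨⟨hK, fun ξ => ?_, hterm t ht, hterm 0 ht0⟩,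
    ⟨?_, ?_, (hΦΦ t ht t ht).1, (hΦΦ 0 ht0 0 ht0).1, (hΦW t ht).mono fun r hr => hr.1,
      hbwint t ht, (hΦΦ 0 ht0 t ht).1, (hΦW 0 ht0).mono fun r hr => hr.1, hbwint 0 ht0⟩,
    (∫ r, w r ∂m) - b t + b 0, fun ξ => ?_, ?_⟩
  · simp_rw [hop, ← real_inner_smul_right]
    exact hW.const_inner (Φ ξ)
  · rw [hmm]
    exact hWWae.mono fun z hz => hz.1
  · rw [IntegrableOn, hmm]
    refine Integrable.congr ?_ (hWWae.mono fun z hz => hz.2.symm)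
    exact integrable_inner_prod hw hw
  · have hb : ∀ r ∈ Set.Icc (0 : ℝ) T,
        inner ℝ (Φ ξ) (b r) = ∫ y, p r y * K (ξ - spaceTime r y) := fun r hr => by
      rw [← integral_inner (hΦp r hr)]
      simp_rw [real_inner_smul_right, hΦ]
    rw [← hrep, inner_add_right, inner_sub_right, hb t ht, hb 0 ht0, residualFun, hint,
      ← integral_inner hw]
    congr 2
    refine integral_congr_ae (hW'.prod_right_ae.mono fun r hr => ?_)
    simp only [w]
    rw [← integral_inner hr]
    simp_rw [real_inner_smul_right, hop]
  · rw [norm_sub_add_sq, termI2, termI3, termI4, termI5, termI6, (hΦΦ t ht t ht).2,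
      (hΦΦ 0 ht0 0 ht0).2, (hΦΦ 0 ht0 t ht).2, hbw t ht, hbw 0 ht0]
    have hI1 : termI1 P K u X X' t = inner ℝ (∫ r, w r ∂m) (∫ r, w r ∂m) := by
      rw [termI1, hint, ← integral_integral_inner hw]
      refine integral_congr_ae (hWlaw.mono fun r hr => ?_)
      simp only
      rw [hint]
      exact integral_congr_ae (hWlaw.mono fun s hs => (hWW s r hs hr).2)
    rw [hI1]
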